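/- **Proposition 5 (Finite-sample guarantees).** Let $0\le k\le d$ and let $\mathcal X=\mathbb R^k\times\mathbb Z^{d-k}\subseteq\mathbb R^d$ be the space of feature vectors with $k$ continuous and $d-k$ discrete (integer-valued) coordinates. Let $\xi$ be a random training parameter with law $\mu$, and let $t(\cdot;\xi):\mathcal X\to\{0,1\}$ be a convex base learner: $t(x;\xi)=1$ if and only if $g(x,\xi)\le 0$, where $g(\cdot,\xi):\mathbb R^d\to\mathbb R$ is convex for every $\xi$ and $g(x,\cdot)$ is measurable for every $x$. For an ensemble $\boldsymbol\xi=(\xi_1,\dots,\xi_N)$ of $N$ i.i.d. parameters with law $\mu$ put $h_N(x;\boldsymbol\xi)=\frac1N\sum_{i=1}^N t(x;\xi_i)$, and let $T(x;\boldsymbol\xi)=1$ if $h_N(x;\boldsymbol\xi)\ge\frac12$ and $T(x;\boldsymbol\xi)=0$ otherwise. Let the admissible domain be $\mathcal D=K\cap\mathcal X$ with $K\subseteq\mathbb R^d$ closed and convex, let $x_{n+1}\in\mathbb R^d$ be an observation, and let $f(\cdot,x_{n+1}):\mathbb R^d\to\mathbb R$ be a convex function (a distance to $x_{n+1}$). Given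 a trained ensemble $\boldsymbol\xi^0\sim\mu^{\otimes N}$, the convex approximated problem is $$\min_x\ f(x,x_{n+1})\quad\text{s.t.}\quad t(x;\xi^0_i)=1\ (i=1,\dots,N),\quad x\in\mathcal D .$$ Its solution $\hat x=\hat x(\boldsymbol\xi^0)$ is its minimizer; if there are several, ties are broken by successively minimizing finitely many fixed convex functions $\varphi_1,\dots,\varphi_q:\mathbb R^d\to\mathbb R$, and $\hat x$ exists if exactly one minimizer is left. Let $0<\alpha\le\frac12$. Call $x$ a robust counterfactual explanation for $\boldsymbol\xi^0$ (with tolerance $\alpha$) if $x\in\mathcal D$, $T(x;\boldsymbol\xi^0)=1$ and $\mathbb P_{\boldsymbol\xi\sim\mu^{\otimes N}}\big(T(x;\boldsymbol\xi)=1\big)\ge 1-\alpha$. Then, with probability at least $1-\delta$ over $\boldsymbol\xi^0$, the solution $\hat x$, if it exists, is a robust counterfactual explanation for $\boldsymbol\xi^0$; that is, the probability that $\hat x$ exists and is not a robust counterfactual explanation is at most $\delta$, where $$\delta=\exp\Big[\big(2^{d-k}(k+1)-1\big)\big(\log(1/\alpha)+\alpha\big)-\tfrac{\alpha}{2}N\Big].$$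 -/

import Mathlib

open MeasureTheory

noncomputable section

/-- Feature vectors with `d` coordinates: the first `k` are continuous (real-valued), the remaining
`d - k` are discrete (integer-valued). -/
def mixedFeatures (d k : ℕ) : Set (Fin d → ℝ) :=
  {x | ∀ i : Fin d, k ≤ i.val → ∃ z : ℤ, x i = z}

/-- `t x ξ` is the class predicted at `x` by the base learner whose random training procedure is
parameterized by `ξ`. The learner is convex when, for every `ξ`, the condition `t x ξ = 1` on
feature vectors is a convex constraint `g x ξ ≤ 0`, with `g` convex in `x` and measurable in `ξ`. -/
def IsConvexLearner {Ξ : Type*} [MeasurableSpace Ξ] (d k : ℕ)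
    (t : (Fin d → ℝ) → Ξ → Fin 2) : Prop :=
  ∃ g : (Fin d → ℝ) → Ξ → ℝ,
    (∀ ξ, ConvexOn ℝ Set.univ (fun x => g x ξ)) ∧
    (∀ x, Measurable (g x)) ∧
    ∀ x ∈ mixedFeatures d k, ∀ ξ, t x ξ = 1 ↔ g x ξ ≤ 0

/-- The score of an ensemble: the average of the classes predicted by its `N` base learners. -/
def score {Ξ : Type*} {d N : ℕ} (t : (Fin d → ℝ) → Ξ → Fin 2) (x : Fin d → ℝ)
    (ξ : Fin N → Ξ) : ℝ :=
  (1 / (N : ℝ)) * ∑ i, ((t x (ξ i)).val : ℝ)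

/-- The class predicted by an ensemble, by majority vote. -/
def ensemble {Ξ : Type*} {d N : ℕ} (t : (Fin d → ℝ) → Ξ → Fin 2) (x : Fin d → ℝ)
    (ξ : Fin N → Ξ) : Fin 2 :=
  if 1 / 2 ≤ score t x ξ then 1 else 0

/-- The law of the training parameters of an ensemble of `N` base learners that are trained
independently and identically, `μ` being the law of the parameter of one base learner. -/
def ensembleLaw {Ξ : Type*} [MeasurableSpace Ξ] (μ : Measure Ξ) (N : ℕ) : Measure (Fin N → Ξ) :=
  Measure.pi fun _ => μ

/-- `x` is robust with tolerance `α`: a freshly trained ensemble of `N` base learners assigns the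
target class to `x` with probability at least `1 - α`. -/
def IsRobust {Ξ : Type*} [MeasurableSpace Ξ] {d : ℕ} (μ : Measure Ξ) (N : ℕ)
    (t : (Fin d → ℝ) → Ξ → Fin 2) (α : ℝ) (x : Fin d → ℝ) : Prop :=
  ENNReal.ofReal (1 - α) ≤ ensembleLaw μ N {ξ | ensemble t x ξ = 1}

/-- `x` is a robust counterfactual explanation for the trained ensemble `ξ₀`: it lies in the domain
of admissible (actionable and plausible) feature vectors, `ξ₀` assigns the target class to it, and
it is robust with tolerance `α`. -/
def IsRobustCounterfactual {Ξ : Type*} [MeasurableSpace Ξ] {d N : ℕ} (μ : Measure Ξ)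
    (t : (Fin d → ℝ) → Ξ → Fin 2) (D : Set (Fin d → ℝ)) (α : ℝ) (ξ₀ : Fin N → Ξ)
    (x : Fin d → ℝ) : Prop :=
  x ∈ D ∧ ensemble t x ξ₀ = 1 ∧ IsRobust μ N t α x

/-- The feasible set of the convex approximation: the admissible feature vectors that all base
learners of the trained ensemble `ξ₀` assign to the target class. -/
def convexApproxFeasible {Ξ : Type*} {d N : ℕ} (t : (Fin d → ℝ) → Ξ → Fin 2)
    (D : Set (Fin d → ℝ)) (ξ₀ : Fin N → Ξ) : Set (Fin d → ℝ) :=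
  {x | x ∈ D ∧ ∀ i, t x (ξ₀ i) = 1}

/-- `x` is the solution of `min f` over `A`, ties being broken by minimizing the functions
`φ 0, φ 1, …` successively. For `q = 0` it says that `x` is the unique minimizer; conversely, a
unique minimizer is the solution for every choice of `φ`. -/
def IsSolution {d q : ℕ} (f : (Fin d → ℝ) → ℝ) (φ : Fin q → (Fin d → ℝ) → ℝ)
    (A : Set (Fin d → ℝ)) (x : Fin d → ℝ) : Prop :=
  x ∈ A ∧ (∀ y ∈ A, f x ≤ f y) ∧
    ∀ y ∈ A, y ≠ x → f y = f x → toLex (fun j => φ j x) < toLex (fun j => φ j y)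

end

/-! Two facts combine. First, a point that a single learner rejects with probability at most `α ≤
1/2` is robust, because a majority of independent errors is no likelier than a single one
(`sum_majority_le`). A solution of the convex problem is accepted by every trained learner, so the
theorem reduces to bounding the probability that the solution of a program with `N` random convex
constraints has violation probability above `α`.

Second, this bound comes from Helly numbers. Write `z = 2^(d-k)(k+1) - 1`. The mixed-integer space
has Helly number at most `z + 1`: a parity argument handles the lattice, and projection adds the
continuous coordinates. The points lexicographically better than the solution form one convex set,
so at most `z` constraints already certify optimality (`exists_support_constraints`).

For a fixed index set `J` of size `M`, the solution of the subsample `J` is independent of the other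
`N - M` constraints. If its violation probability exceeds `α`, it survives them with probability at
most `(1-α)^(N-M)`. A bad sample produces this event for every `J` containing its `z` support
indices. Averaging over all `J`, in place of a union bound over supports, costs only `C(N,M) /
C(N-z,M-z) = C(N,z) / C(M,z)`. This is at most `2^z` for `M = ⌊(N+z)/2⌋`, and `2 ≤ 1/α` with `1 - α
≤ exp(-α)` yields the exponent.

Fubini and Markov require measurable events, which the theory of random closed sets supplies. -/

/-! ### Helly numbers of the lattice and of mixed-integer space -/

/-- Every finite family of convex sets of which any `h` members have a common point in `M` has a
common point in `M`. -/
def IsHellyNumber {F : Type*} [AddCommGroup F] [Module ℝ F] (M : Set F) (h : ℕ) : Prop :=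
  ∀ (ι : Type) (s : Finset ι) (C : ι → Set F), (∀ i ∈ s, Convex ℝ (C i)) →
    (∀ I ⊆ s, I.card ≤ h → ∃ x ∈ M, ∀ i ∈ I, x ∈ C i) → ∃ x ∈ M, ∀ i ∈ s, x ∈ C i

/-- A system of strict upper bounds without solution in a finite set can be relaxed so that it
still has no solution, but each bound of it is attained at a point that satisfies the others. -/
theorem exists_tight_bounds {ι P : Type*} [DecidableEq ι] (Z : Finset P) (s : Finset ι)
    (a : ι → P → ℝ) (b : ι → ℝ) (hno : ∀ z ∈ Z, ∃ i ∈ s, b i ≤ a i z)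
    (hmin : ∀ i ∈ s, ∃ z ∈ Z, ∀ j ∈ s, j ≠ i → a j z < b j) (T : Finset ι) (hT : T ⊆ s) :
    ∃ β : ι → ℝ, (∀ i, b i ≤ β i) ∧ (∀ z ∈ Z, ∃ i ∈ s, β i ≤ a i z) ∧
      ∀ i ∈ T, ∃ z ∈ Z, a i z = β i ∧ ∀ j ∈ s, j ≠ i → a j z < β j := by
  induction T using Finset.induction_on with
  | empty => exact ⟨b, fun _ => le_rfl, hno, by simp⟩
  | insert i T hi ih =>
    obtain ⟨β, hb, hβ, hTβ⟩ := ih ((Finset.subset_insert i T).trans hT)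
    have his : i ∈ s := hT (Finset.mem_insert_self i T)
    classical
    -- Bound `i` is raised to the minimum of `a i` over the points that satisfy all other bounds.
    -- Points outside `Y` still violate another bound. Bounds only increase, so the witnesses found
    -- earlier remain valid.
    set Y := Z.filter fun z => ∀ j ∈ s, j ≠ i → a j z < β j with hY
    have hYne : Y.Nonempty := by
      obtain ⟨z, hz, hz'⟩ := hmin i his
      exact ⟨z, Finset.mem_filter.2 ⟨hz, fun j hj hji => (hz' j hj hji).trans_le (hb j)⟩⟩
    obtain ⟨y, hyY, hymin⟩ := Finset.exists_min_image Y (a i) hYne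
    obtain ⟨hyZ, hy⟩ := Finset.mem_filter.1 hyY
    have hβi : β i ≤ a i y := by
      obtain ⟨j, hj, hjy⟩ := hβ y hyZ
      by_cases hji : j = i
      · exact hji ▸ hjy
      · exact absurd (hy j hj hji) (not_lt.2 hjy)
    have hle : ∀ j, β j ≤ Function.update β i (a i y) j := by
      intro j
      by_cases hji : j = i
      · subst hji; simpa using hβi
      · simp [hji]
    refine ⟨Function.update β i (a i y), fun j => (hb j).trans (hle j), ?_, ?_⟩
    · intro z hz
      by_cases hzY : z ∈ Y
      · exact ⟨i, his, by simpa using hymin z hzY⟩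
      · have : ∃ j ∈ s, j ≠ i ∧ β j ≤ a j z := by
          by_contra! hcon
          exact hzY (Finset.mem_filter.2 ⟨hz, hcon⟩)
        obtain ⟨j, hj, hji, hjz⟩ := this
        exact ⟨j, hj, by simpa [hji] using hjz⟩
    · intro j hj
      rcases Finset.mem_insert.1 hj with rfl | hjT
      · exact ⟨y, hyZ, by simp, fun l hl hlj => by simpa [hlj] using hy l hl hlj⟩
      · have hji : j ≠ i := fun h => hi (h ▸ hjT)
        obtain ⟨z, hz, hz1, hz2⟩ := hTβ j hjT
        exact ⟨z, hz, by simpa [hji] using hz1, fun l hl hlj => (hz2 l hl hlj).trans_le (hle l)⟩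

/-- Helly's theorem for finitely many half-spaces and a finite set of integer vectors that is closed
under integral midpoints. -/
theorem helly_halfspaces_int {ι : Type*} {n : ℕ} (Z : Finset (Fin n → ℤ))
    (hZ : ∀ u ∈ Z, ∀ v ∈ Z, ∀ w, u + v = w + w → w ∈ Z) (s : Finset ι)
    (a : ι → (Fin n → ℤ) →+ ℝ) (b : ι → ℝ)
    (h : ∀ I ⊆ s, I.card ≤ 2 ^ n → ∃ z ∈ Z, ∀ i ∈ I, a i z < b i) :
    ∃ z ∈ Z, ∀ i ∈ s, a i z < b i := by
  classical
  induction hc : s.card using Nat.strong_induction_on generalizing s with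
  | _ c ih =>
  by_contra! hno
  have hcard : 2 ^ n < s.card := by
    by_contra! hle
    obtain ⟨z, hz, hz'⟩ := h s subset_rfl hle
    obtain ⟨i, hi, hi'⟩ := hno z hz
    exact absurd (hz' i hi) (not_lt.2 hi')
  have hmin : ∀ i ∈ s, ∃ z ∈ Z, ∀ j ∈ s, j ≠ i → a j z < b j := by
    intro i hi
    obtain ⟨z, hz, hz'⟩ := ih _ (hc ▸ Finset.card_erase_lt_of_mem hi) (s.erase i)
      (fun I hI => h I (hI.trans (Finset.erase_subset i s))) rfl
    exact ⟨z, hz, fun j hj hji => hz' j (Finset.mem_erase.2 ⟨hji, hj⟩)⟩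
  obtain ⟨β, -, hβ, hz⟩ := exists_tight_bounds Z s (fun i z => a i z) b hno hmin s subset_rfl
  choose! z hzZ hzeq hzlt using hz
  -- There are more witnesses than parity classes, so two agree modulo 2 and their midpoint `w` lies
  -- in `Z`. Each witness attains only its own bound, hence `w` satisfies every bound strictly,
  -- against `hβ`.
  obtain ⟨i, hi, j, hj, hij, hmod⟩ : ∃ i ∈ s, ∃ j ∈ s, i ≠ j ∧
      (fun l => (z i l : ZMod 2)) = fun l => (z j l : ZMod 2) := by
    refine Finset.exists_ne_map_eq_of_card_lt_of_maps_to (t := Finset.univ) ?_ (by simp)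
    simpa [ZMod.card] using hcard
  have hpar : ∀ l, ∃ m : ℤ, z i l + z j l = m + m := by
    intro l
    have h1 := (ZMod.intCast_eq_intCast_iff_dvd_sub _ _ 2).1 (congrFun hmod l)
    obtain ⟨m, hm⟩ := h1
    exact ⟨z i l + m, by push_cast at hm; omega⟩
  choose w hw using hpar
  have hw' : z i + z j = w + w := funext hw
  obtain ⟨l, hl, hlw⟩ := hβ w (hZ _ (hzZ i hi) _ (hzZ j hj) w hw')
  have hsum : a l (z i) + a l (z j) = a l w + a l w := by rw [← map_add, hw', map_add]
  by_cases hli : l = i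
  · subst hli
    linarith [hzeq l hl, hzlt j hj l hl hij]
  · by_cases hlj : l = j
    · subst hlj
      linarith [hzeq l hl, hzlt i hi l hl hli]
    · linarith [hzlt i hi l hl hli, hzlt j hj l hl hlj]

/-- The embedding of integer vectors into real vectors. -/
noncomputable def intVec (n : ℕ) : (Fin n → ℤ) →+ (Fin n → ℝ) where
  toFun z i := z i
  map_zero' := by ext; simp
  map_add' x y := by ext; simp

@[simp] theorem intVec_apply {n : ℕ} (z : Fin n → ℤ) (i : Fin n) : intVec n z i = z i := rfl

theorem finite_intVec_mem {n : ℕ} {B : Set (Fin n → ℝ)} (hB : Bornology.IsBounded B) :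
    {z : Fin n → ℤ | intVec n z ∈ B}.Finite := by
  obtain ⟨R, hR⟩ := hB.exists_norm_le
  refine (Set.finite_Icc (fun _ : Fin n => -⌈R⌉) (fun _ => ⌈R⌉)).subset fun z hz => ?_
  have h1 : ∀ i, |(z i : ℝ)| ≤ R := fun i => by
    simpa using (norm_le_pi_norm (intVec n z) i).trans (hR _ hz)
  constructor <;> intro i <;> have h2 := abs_le.1 (h1 i) <;> have h3 := Int.le_ceil R
  · have : ((-⌈R⌉ : ℤ) : ℝ) ≤ z i := by push_cast; linarith
    exact_mod_cast this
  · have : (z i : ℝ) ≤ (⌈R⌉ : ℤ) := by linarith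
    exact_mod_cast this

/-- Doignon's theorem: the Helly number of the integer lattice in dimension `n` is at most `2 ^ n`. -/
theorem isHellyNumber_int (n : ℕ) : IsHellyNumber (Set.range (intVec n)) (2 ^ n) := by
  classical
  intro ι s C hC h
  have h' : ∀ I, ∃ z : Fin n → ℤ, I ⊆ s → I.card ≤ 2 ^ n → ∀ i ∈ I, intVec n z ∈ C i := by
    intro I
    by_cases hI : I ⊆ s ∧ I.card ≤ 2 ^ n
    · obtain ⟨_, ⟨z, rfl⟩, hz⟩ := h I hI.1 hI.2
      exact ⟨z, fun _ _ => hz⟩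
    · exact ⟨0, fun h1 h2 => absurd ⟨h1, h2⟩ hI⟩
  choose w hw using h'
  -- With one witness per small subfamily, each `C i` can be shrunk to the polytope spanned by `C i
  -- ∩ W`. The default witness `0` of the large subfamilies does no harm.
  set W : Set (Fin n → ℝ) := (fun I => intVec n (w I)) '' (s.powerset : Set (Finset ι)) with hW
  have hWf : W.Finite := (Finset.finite_toSet _).image _
  have hcpt : ∀ i, IsCompact (convexHull ℝ (C i ∩ W)) := fun i =>
    (hWf.subset Set.inter_subset_right).isCompact_convexHull ℝ
  have hZf : {z : Fin n → ℤ | intVec n z ∈ convexHull ℝ W}.Finite :=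
    finite_intVec_mem (hWf.isCompact_convexHull ℝ).isBounded
  have hZmem : ∀ z, z ∈ hZf.toFinset ↔ intVec n z ∈ convexHull ℝ W := by simp
  -- Only finitely many integer points matter, so one separating half-space for each pair of a set
  -- and a point replaces the polytopes. A point inside the polytope gets the vacuous condition `0 <
  -- 1`.
  have hsep : ∀ p : ι × (Fin n → ℤ), ∃ (l : (Fin n → ℝ) →L[ℝ] ℝ) (u : ℝ),
      (∀ x ∈ convexHull ℝ (C p.1 ∩ W), l x < u) ∧
      (intVec n p.2 ∉ convexHull ℝ (C p.1 ∩ W) → u ≤ l (intVec n p.2)) := by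
    intro p
    by_cases hp : intVec n p.2 ∈ convexHull ℝ (C p.1 ∩ W)
    · exact ⟨0, 1, by simp, fun h => absurd hp h⟩
    · obtain ⟨l, u, h1, h2⟩ := geometric_hahn_banach_closed_point (convex_convexHull ℝ _)
        (hcpt p.1).isClosed hp
      exact ⟨l, u, h1, fun _ => h2.le⟩
  choose l u hlt hle using hsep
  obtain ⟨z, hzZ, hz⟩ := helly_halfspaces_int hZf.toFinset (by
      intro x hx y hy v hv
      rw [hZmem] at *
      have hmid := (convex_convexHull ℝ W) hx hy (a := 1 / 2) (b := 1 / 2) (by norm_num)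
        (by norm_num) (by norm_num)
      convert hmid using 1
      have hv' := congrArg (intVec n) hv
      rw [map_add, map_add] at hv'
      rw [← smul_add, hv', ← two_smul ℝ, smul_smul]
      norm_num) (s ×ˢ hZf.toFinset)
    (fun p => ((l p : (Fin n → ℝ) →L[ℝ] ℝ) : (Fin n → ℝ) →+ ℝ).comp (intVec n)) u (by
      intro I hI hIc
      have hIs : I.image Prod.fst ⊆ s := by
        intro i hi
        obtain ⟨p, hp, rfl⟩ := Finset.mem_image.1 hi
        exact (Finset.mem_product.1 (hI hp)).1
      have hwI : intVec n (w (I.image Prod.fst)) ∈ W :=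
        ⟨_, Finset.mem_coe.2 (Finset.mem_powerset.2 hIs), rfl⟩
      refine ⟨w (I.image Prod.fst), (hZmem _).2 (subset_convexHull ℝ W hwI), fun p hp => ?_⟩
      refine hlt p _ (subset_convexHull ℝ _ ⟨?_, hwI⟩)
      exact hw _ hIs (Finset.card_image_le.trans hIc) _ (Finset.mem_image_of_mem _ hp))
  refine ⟨intVec n z, ⟨z, rfl⟩, fun i hi => ?_⟩
  have hzi : intVec n z ∈ convexHull ℝ (C i ∩ W) := by
    by_contra hcon
    exact absurd (hz (i, z) (Finset.mem_product.2 ⟨hi, hzZ⟩)) (not_lt.2 (hle (i, z) hcon))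
  exact convexHull_min Set.inter_subset_left (hC i hi) hzi

/-- Adding continuous coordinates multiplies a Helly number by their number plus one. -/
theorem IsHellyNumber.univ_prod {E F : Type*} [AddCommGroup E] [Module ℝ E]
    [FiniteDimensional ℝ E] [AddCommGroup F] [Module ℝ F] {M : Set F} {h : ℕ}
    (hM : IsHellyNumber M h) :
    IsHellyNumber (Set.univ ×ˢ M : Set (E × F)) (h * (Module.finrank ℝ E + 1)) := by
  classical
  intro ι s C hC hI
  -- The hypothesis on `M` is applied to the shadows in `F` of the intersections of at most `finrank
  -- + 1` members. Any `h` of these shadows involve at most `h * (finrank + 1)` members. Classical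
  -- Helly then applies in the fibre over the common point `z`.
  obtain ⟨z, hzM, hz⟩ := hM (Finset ι)
    (s.powerset.filter fun I => I.card ≤ Module.finrank ℝ E + 1)
    (fun I => LinearMap.snd ℝ E F '' ⋂ i ∈ I, C i) (by
      intro I hI
      have hIs := Finset.mem_powerset.1 (Finset.mem_filter.1 hI).1
      exact (convex_iInter₂ fun i hi => hC i (hIs hi)).linear_image _) (by
      intro 𝓘 h𝓘 hcard
      obtain ⟨x, hx, hxC⟩ := hI (𝓘.biUnion id) (by
        intro i hi
        obtain ⟨I, hI𝓘, hiI⟩ := Finset.mem_biUnion.1 hi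
        exact Finset.mem_powerset.1 (Finset.mem_filter.1 (h𝓘 hI𝓘)).1 hiI)
        ((Finset.card_biUnion_le_card_mul _ _ _ fun I hI' =>
          (Finset.mem_filter.1 (h𝓘 hI')).2).trans (Nat.mul_le_mul_right _ hcard))
      refine ⟨x.2, hx.2, fun I hI' => ⟨x, ?_, rfl⟩⟩
      exact Set.mem_iInter₂.2 fun i hi => hxC i (Finset.mem_biUnion.2 ⟨I, hI', hi⟩))
  obtain ⟨e, he⟩ := Convex.helly_theorem' (𝕜 := ℝ) (s := s)
    (F := fun i => {e : E | (e, z) ∈ C i})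
    (by
      intro i hi x hx y hy a b ha hb hab
      have := hC i hi hx hy ha hb hab
      have hzz : a • z + b • z = z := by rw [← add_smul, hab, one_smul]
      simpa [Prod.smul_mk, Prod.mk_add_mk, hzz] using this)
    (by
      intro I hIs hIc
      obtain ⟨x, hx, hxz⟩ := hz I (Finset.mem_filter.2 ⟨Finset.mem_powerset.2 hIs, hIc⟩)
      refine ⟨x.1, Set.mem_iInter₂.2 fun i hi => ?_⟩
      have hxz' : x.2 = z := hxz
      have := Set.mem_iInter₂.1 hx i hi
      rwa [← hxz'])
  exact ⟨(e, z), ⟨trivial, hzM⟩, fun i hi => Set.mem_iInter₂.1 he i hi⟩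

/-- The Helly number of the mixed-integer feature space. -/
theorem isHellyNumber_mixedFeatures {d k : ℕ} (hk : k ≤ d) :
    IsHellyNumber (mixedFeatures d k) (2 ^ (d - k) * (k + 1)) := by
  obtain ⟨n, rfl⟩ := Nat.exists_eq_add_of_le hk
  intro ι s C hC h
  let Φ : ((Fin k → ℝ) × (Fin n → ℝ)) →ₗ[ℝ] (Fin (k + n) → ℝ) :=
    { toFun := fun x => Fin.append x.1 x.2
      map_add' := fun x y => by
        ext i; refine Fin.addCases (fun i => ?_) (fun i => ?_) i <;> simp
      map_smul' := fun c x => by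
        ext i; refine Fin.addCases (fun i => ?_) (fun i => ?_) i <;> simp }
  have hprod := (isHellyNumber_int n).univ_prod (E := Fin k → ℝ)
  obtain ⟨x, ⟨-, z, hz⟩, hx⟩ := hprod ι s (fun i => Φ ⁻¹' C i)
    (fun i hi => (hC i hi).linear_preimage Φ) (by
      intro I hI hIc
      obtain ⟨x, hx, hxC⟩ := h I hI (by simpa using hIc)
      choose z hz using fun j : Fin n => hx (Fin.natAdd k j) (by simp)
      refine ⟨(fun i => x (Fin.castAdd n i), fun j => x (Fin.natAdd k j)),
        ⟨trivial, z, by ext j; simp [hz]⟩, fun i hi => ?_⟩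
      have : Φ (fun i => x (Fin.castAdd n i), fun j => x (Fin.natAdd k j)) = x := by
        ext i; refine Fin.addCases (fun i => ?_) (fun i => ?_) i <;> simp [Φ]
      simpa [this] using hxC i hi)
  refine ⟨Φ x, ?_, hx⟩
  intro i
  refine Fin.addCases (fun i hi => ?_) (fun i _ => ?_) i
  · have := i.isLt
    simp at hi
    omega
  · exact ⟨z i, by simp [Φ, ← hz]⟩

/-! ### Random closed sets and lexicographic minimization -/

/-- A random closed set: the event that it meets a given compact set is measurable. -/
structure IsRandomClosed {Ω E : Type*} [MeasurableSpace Ω] [TopologicalSpace E]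
    (A : Ω → Set E) : Prop where
  isClosed : ∀ ω, IsClosed (A ω)
  measurableSet_hit : ∀ C, IsCompact C → MeasurableSet {ω | (A ω ∩ C).Nonempty}

/-- The minimizers of `f` over `A`. -/
def argmin {E : Type*} (f : E → ℝ) (A : Set E) : Set E :=
  {x | x ∈ A ∧ ∀ y ∈ A, f x ≤ f y}

/-- The points of `A` left after successive minimization of the functions of a list. -/
def lexArgmin {E : Type*} : List (E → ℝ) → Set E → Set E
  | [], A => A
  | f :: L, A => lexArgmin L (argmin f A)

/-- Strict lexicographic comparison of the values of a list of functions. -/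
def LexLt {E : Type*} : List (E → ℝ) → E → E → Prop
  | [], _, _ => False
  | f :: L, x, y => f x < f y ∨ f x = f y ∧ LexLt L x y

theorem mem_lexArgmin_iff {E : Type*} (L : List (E → ℝ)) (A : Set E) (x : E) :
    x ∈ lexArgmin L A ↔ x ∈ A ∧ ∀ y ∈ A, ¬ LexLt L y x := by
  induction L generalizing A with
  | nil => simp [lexArgmin, LexLt]
  | cons f L ih =>
    simp only [lexArgmin, ih, argmin, LexLt, Set.mem_ofPred_eq]
    constructor
    · rintro ⟨⟨hx, hmin⟩, h⟩
      refine ⟨hx, fun y hy hlt => ?_⟩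
      rcases hlt with hlt | ⟨heq, hlt⟩
      · exact absurd hlt (not_lt.2 (hmin y hy))
      · exact h y ⟨hy, fun z hz => heq ▸ hmin z hz⟩ hlt
    · rintro ⟨hx, h⟩
      have hmin : ∀ y ∈ A, f x ≤ f y := fun y hy => not_lt.1 fun hlt => h y hy (Or.inl hlt)
      exact ⟨⟨hx, hmin⟩, fun y hy hlt => h y hy.1 (Or.inr ⟨le_antisymm (hy.2 x hx) (hmin y hy.1), hlt⟩)⟩

theorem lexArgmin_subset {E : Type*} (L : List (E → ℝ)) (A : Set E) : lexArgmin L A ⊆ A :=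
  fun x hx => ((mem_lexArgmin_iff L A x).1 hx).1

theorem eq_of_mem_lexArgmin {E : Type*} (L : List (E → ℝ)) (A : Set E) {x y : E}
    (hx : x ∈ lexArgmin L A) (hy : y ∈ lexArgmin L A) {f : E → ℝ} (hf : f ∈ L) : f x = f y := by
  induction L generalizing A with
  | nil => simp at hf
  | cons g L ih =>
    rcases List.mem_cons.1 hf with rfl | hf
    · have hx' := lexArgmin_subset L _ hx
      have hy' := lexArgmin_subset L _ hy
      exact le_antisymm (hx'.2 y hy'.1) (hy'.2 x hx'.1)
    · exact ih _ hx hy hf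

/-- If either endpoint is strictly better in `f`, so is every point strictly between them. If both
tie with `x`, a point between them is either strictly better or tied, and the tail of the list
decides. Thus the whole tie-breaking objective counts as a single convex set in Helly's theorem. -/
theorem convex_lexLt {E : Type*} [AddCommGroup E] [Module ℝ E] (L : List (E → ℝ))
    (hL : ∀ f ∈ L, ConvexOn ℝ Set.univ f) (x : E) : Convex ℝ {y | LexLt L y x} := by
  induction L with
  | nil => simpa [LexLt] using convex_empty
  | cons f L ih =>
    have hfc := hL f (by simp)
    have ih := ih fun g hg => hL g (by simp [hg])
    intro y hy z hz a b ha hb hab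
    rcases ha.eq_or_lt with rfl | ha'
    · obtain rfl : b = 1 := by linarith
      simpa using hz
    rcases hb.eq_or_lt with rfl | hb'
    · obtain rfl : a = 1 := by linarith
      simpa using hy
    have hle : f (a • y + b • z) ≤ a * f y + b * f z := by
      simpa using hfc.2 (Set.mem_univ y) (Set.mem_univ z) ha hb hab
    have hx : a * f x + b * f x = f x := by rw [← add_mul, hab, one_mul]
    rcases hy with hy | ⟨hy, hy'⟩ <;> rcases hz with hz | ⟨hz, hz'⟩
    · left
      linarith [mul_lt_mul_of_pos_left hy ha', mul_lt_mul_of_pos_left hz hb']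
    · left
      rw [hz] at hle
      linarith [mul_lt_mul_of_pos_left hy ha']
    · left
      rw [hy] at hle
      linarith [mul_lt_mul_of_pos_left hz hb']
    · have : f (a • y + b • z) ≤ f x := by rw [hy, hz, ← add_mul, hab, one_mul] at hle; exact hle
      rcases this.lt_or_eq with h | h
      · exact Or.inl h
      · exact Or.inr ⟨h, ih hy' hz' ha hb hab⟩

/-! ### Measurability of solution sets and violation probabilities -/

section Measurability

variable {Ω Ω' E : Type*} [MeasurableSpace Ω] [MeasurableSpace Ω']

theorem IsRandomClosed.comp [TopologicalSpace E] {A : Ω → Set E} (hA : IsRandomClosed A)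
    {T : Ω' → Ω} (hT : Measurable T) : IsRandomClosed fun ω => A (T ω) :=
  ⟨fun _ => hA.isClosed _, fun C hC => hT (hA.measurableSet_hit C hC)⟩

theorem IsRandomClosed.measurableSet_hit_iUnion [TopologicalSpace E] {A : Ω → Set E}
    (hA : IsRandomClosed A) {C : ℕ → Set E} (hC : ∀ n, IsCompact (C n)) :
    MeasurableSet {ω | (A ω ∩ ⋃ n, C n).Nonempty} := by
  have : {ω | (A ω ∩ ⋃ n, C n).Nonempty} = ⋃ n, {ω | (A ω ∩ C n).Nonempty} := by
    ext ω
    simp [Set.inter_iUnion, Set.nonempty_iUnion]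
  rw [this]
  exact MeasurableSet.iUnion fun n => hA.measurableSet_hit _ (hC n)

theorem IsRandomClosed.measurableSet_hit_isClosed [TopologicalSpace E] [SigmaCompactSpace E]
    {A : Ω → Set E} (hA : IsRandomClosed A) {C : Set E} (hC : IsClosed C) :
    MeasurableSet {ω | (A ω ∩ C).Nonempty} := by
  have := hA.measurableSet_hit_iUnion fun n => (isCompact_compactCovering E n).inter_right hC
  rwa [← Set.iUnion_inter, iUnion_compactCovering, Set.univ_inter] at this

theorem IsRandomClosed.measurableSet_hit_isOpen [PseudoMetricSpace E] [SigmaCompactSpace E]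
    {A : Ω → Set E} (hA : IsRandomClosed A) {U : Set E} (hU : IsOpen U) :
    MeasurableSet {ω | (A ω ∩ U).Nonempty} := by
  obtain ⟨F, hF, -, rfl, -⟩ := hU.exists_iUnion_isClosed
  have : {ω | (A ω ∩ ⋃ n, F n).Nonempty} = ⋃ n, {ω | (A ω ∩ F n).Nonempty} := by
    ext ω
    simp [Set.inter_iUnion, Set.nonempty_iUnion]
  rw [this]
  exact MeasurableSet.iUnion fun n => hA.measurableSet_hit_isClosed (hF n)

/-- A minimizer lies in the compact set `C` exactly when `A` meets `C` and every rational level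
reached on `A` is also reached on `A ∩ C`. Compactness provides a minimizer on `A ∩ C`. -/
theorem IsRandomClosed.argmin [TopologicalSpace E] [SigmaCompactSpace E] {A : Ω → Set E}
    (hA : IsRandomClosed A) {f : E → ℝ} (hf : Continuous f) :
    IsRandomClosed fun ω => argmin f (A ω) := by
  refine ⟨fun ω => ?_, fun C hC => ?_⟩
  · have : _root_.argmin f (A ω) = A ω ∩ ⋂ y ∈ A ω, {x | f x ≤ f y} := by
      ext x; simp [_root_.argmin]
    rw [this]
    exact (hA.isClosed ω).inter (isClosed_biInter fun y _ => isClosed_le hf continuous_const)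
  · have hr : ∀ r : ℝ, IsClosed {x | f x ≤ r} := fun r => isClosed_le hf continuous_const
    have : {ω | (_root_.argmin f (A ω) ∩ C).Nonempty} = {ω | (A ω ∩ C).Nonempty} ∩
        ⋂ r : ℚ, ({ω | (A ω ∩ {x | f x ≤ r}).Nonempty}ᶜ ∪
          {ω | (A ω ∩ (C ∩ {x | f x ≤ r})).Nonempty}) := by
      ext ω
      simp only [Set.mem_ofPred_eq, Set.mem_inter_iff, Set.mem_iInter, Set.mem_union,
        Set.mem_compl_iff]
      constructor
      · rintro ⟨x, ⟨hxA, hmin⟩, hxC⟩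
        refine ⟨⟨x, hxA, hxC⟩, fun r => ?_⟩
        by_cases h : (A ω ∩ {x | f x ≤ r}).Nonempty
        · obtain ⟨y, hyA, hy⟩ := h
          exact Or.inr ⟨x, hxA, hxC, (hmin y hyA).trans hy⟩
        · exact Or.inl h
      · rintro ⟨hne, h⟩
        obtain ⟨x, ⟨hxA, hxC⟩, hmin⟩ := (hC.inter_left (hA.isClosed ω)).exists_isMinOn hne
          hf.continuousOn
        refine ⟨x, ⟨hxA, fun y hy => ?_⟩, hxC⟩
        by_contra! hlt
        obtain ⟨r, hr1, hr2⟩ := exists_rat_btwn hlt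
        rcases h r with h | ⟨z, hzA, hzC, hz⟩
        · exact h ⟨y, hy, hr1.le⟩
        · exact absurd (hmin ⟨hzA, hzC⟩) (not_le.2 (lt_of_le_of_lt hz hr2))
    rw [this]
    exact (hA.measurableSet_hit C hC).inter (MeasurableSet.iInter fun r =>
      (hA.measurableSet_hit_isClosed (hr r)).compl.union
        (hA.measurableSet_hit _ (hC.inter_right (hr r))))

theorem IsRandomClosed.lexArgmin [TopologicalSpace E] [SigmaCompactSpace E] {A : Ω → Set E}
    (hA : IsRandomClosed A) (L : List (E → ℝ)) (hL : ∀ f ∈ L, Continuous f) :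
    IsRandomClosed fun ω => lexArgmin L (A ω) := by
  induction L generalizing A with
  | nil => exact hA
  | cons f L ih =>
    exact ih (hA.argmin (hL f (by simp))) fun g hg => hL g (by simp [hg])

/-- Inside a compact set, two closed sets meet as soon as, at every scale, both have points near a
common point of a countable dense set. A convergent subsequence gives the common point. -/
theorem IsRandomClosed.inter [PseudoMetricSpace E] [SigmaCompactSpace E]
    {A B : Ω → Set E} (hA : IsRandomClosed A) (hB : IsRandomClosed B) :
    IsRandomClosed fun ω => A ω ∩ B ω := by
  refine ⟨fun ω => (hA.isClosed ω).inter (hB.isClosed ω), fun C hC => ?_⟩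
  obtain ⟨Q, hQc, hQd⟩ := TopologicalSpace.exists_countable_dense E
  have : {ω | (A ω ∩ B ω ∩ C).Nonempty} = ⋂ n : ℕ, ⋃ q ∈ Q,
      ({ω | (A ω ∩ (C ∩ Metric.closedBall q (1 / (n + 1)))).Nonempty} ∩
        {ω | (B ω ∩ (C ∩ Metric.closedBall q (1 / (n + 1)))).Nonempty}) := by
    ext ω
    simp only [Set.mem_ofPred_eq, Set.mem_iInter, Set.mem_iUnion, Set.mem_inter_iff, exists_prop]
    constructor
    · rintro ⟨x, ⟨hxA, hxB⟩, hxC⟩ n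
      obtain ⟨q, hq, hxq⟩ := hQd.exists_dist_lt x (ε := 1 / ((n : ℝ) + 1)) (by positivity)
      exact ⟨q, hq, ⟨x, hxA, hxC, hxq.le⟩, ⟨x, hxB, hxC, hxq.le⟩⟩
    · intro h
      choose q _ hx hy using h
      choose x hxA hxC hxq using hx
      choose y hyB hyC hyq using hy
      obtain ⟨z, hz, σ, hσ, hlim⟩ := hC.tendsto_subseq hxC
      have hd : Filter.Tendsto (fun n => dist (x n) (y n)) Filter.atTop (nhds 0) := by
        refine squeeze_zero (fun _ => dist_nonneg)
          (g := fun n : ℕ => 1 / ((n : ℝ) + 1) + 1 / ((n : ℝ) + 1)) (fun n => ?_) ?_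
        · exact (dist_triangle_right _ _ (q n)).trans (add_le_add (hxq n) (hyq n))
        · simpa using (tendsto_one_div_add_atTop_nhds_zero_nat (𝕜 := ℝ)).add
            (tendsto_one_div_add_atTop_nhds_zero_nat (𝕜 := ℝ))
      have hlim' : Filter.Tendsto (y ∘ σ) Filter.atTop (nhds z) :=
        (tendsto_iff_of_dist (hd.comp hσ.tendsto_atTop)).1 hlim
      exact ⟨z, ⟨(hA.isClosed ω).mem_of_tendsto hlim (Filter.Eventually.of_forall fun n => hxA _),
        (hB.isClosed ω).mem_of_tendsto hlim' (Filter.Eventually.of_forall fun n => hyB _)⟩, hz⟩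
  rw [this]
  refine MeasurableSet.iInter fun n => MeasurableSet.biUnion hQc fun q _ => ?_
  have hcl : IsCompact (C ∩ Metric.closedBall q (1 / ((n : ℝ) + 1))) :=
    hC.inter_right Metric.isClosed_closedBall
  exact (hA.measurableSet_hit _ hcl).inter (hB.measurableSet_hit _ hcl)

/-- The solution set of finitely many random constraints that are continuous in the variable. -/
theorem isRandomClosed_constraints [PseudoMetricSpace E] [SigmaCompactSpace E] {ι : Type*} [Finite ι]
    {D : Set E} (hD : IsClosed D) (g : ι → E → Ω → ℝ) (hgc : ∀ i ω, Continuous fun x => g i x ω)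
    (hgm : ∀ i x, Measurable (g i x)) :
    IsRandomClosed fun ω => {x | x ∈ D ∧ ∀ i, g i x ω ≤ 0} := by
  refine ⟨fun ω => ?_, fun C hC => ?_⟩
  · have : {x | x ∈ D ∧ ∀ i, g i x ω ≤ 0} = D ∩ ⋂ i, {x | g i x ω ≤ 0} := by ext x; simp
    rw [this]
    exact hD.inter (isClosed_iInter fun i => isClosed_le (hgc i ω) continuous_const)
  · have hcpt : IsCompact (D ∩ C) := hC.inter_left hD
    obtain ⟨Q, hQs, hQc, hQd⟩ := 
      (TopologicalSpace.IsSeparable.of_separableSpace (D ∩ C)).exists_countable_dense_subset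
    -- The slack `1 / (n + 1)` makes the constraints open, so they can be tested on a countable
    -- dense set. Compactness removes the slack in the limit.
    have : {ω | ({x | x ∈ D ∧ ∀ i, g i x ω ≤ 0} ∩ C).Nonempty} =
        ⋂ n : ℕ, ⋃ q ∈ Q, ⋂ i, {ω | g i q ω < 1 / ((n : ℝ) + 1)} := by
      ext ω
      simp only [Set.mem_ofPred_eq, Set.mem_iInter, Set.mem_iUnion, exists_prop]
      constructor
      · rintro ⟨x, ⟨hxD, hx⟩, hxC⟩ n
        have hU : IsOpen (⋂ i, {x | g i x ω < 1 / ((n : ℝ) + 1)}) :=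
          isOpen_iInter_of_finite fun i => isOpen_lt (hgc i ω) continuous_const
        obtain ⟨q, hqU, hq⟩ := mem_closure_iff.1 (hQd ⟨hxD, hxC⟩) _ hU
          (Set.mem_iInter.2 fun i => (hx i).trans_lt (by positivity))
        exact ⟨q, hq, fun i => Set.mem_iInter.1 hqU i⟩
      · intro h
        choose q hqQ hq using h
        obtain ⟨z, hz, σ, hσ, hlim⟩ := hcpt.tendsto_subseq fun n => hQs (hqQ n)
        refine ⟨z, ⟨hz.1, fun i => ?_⟩, hz.2⟩
        refine le_of_tendsto_of_tendsto' (((hgc i ω).tendsto z).comp hlim)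
          ((tendsto_one_div_add_atTop_nhds_zero_nat (𝕜 := ℝ)).comp hσ.tendsto_atTop)
          fun n => (hq (σ n) i).le
    rw [this]
    exact MeasurableSet.iInter fun n => MeasurableSet.biUnion hQc fun q _ =>
      MeasurableSet.iInter fun i => measurableSet_lt (hgm i q) measurable_const

/-- The probability that a continuous random constraint is violated is lower semicontinuous. -/
theorem isOpen_lt_measure_pos [PseudoMetricSpace E] (μ : Measure Ω) (g : E → Ω → ℝ)
    (hgc : ∀ ω, Continuous fun x => g x ω) (hgm : ∀ x, Measurable (g x)) (a : ENNReal) :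
    IsOpen {x | a < μ {ω | 0 < g x ω}} := by
  rw [← isClosed_compl_iff]
  refine IsSeqClosed.isClosed fun x z hx hlim => ?_
  simp only [Set.mem_compl_iff, Set.mem_ofPred_eq, not_lt] at hx ⊢
  have hm : ∀ y, MeasurableSet {ω | 0 < g y ω} := fun y =>
    measurableSet_lt measurable_const (hgm y)
  -- Fatou's lemma: strict violation at `z` persists along a sequence tending to `z`.
  calc μ {ω | 0 < g z ω} = ∫⁻ ω, {ω | 0 < g z ω}.indicator 1 ω ∂μ := (lintegral_indicator_one (hm z)).symm
    _ ≤ ∫⁻ ω, Filter.liminf (fun n => {ω | 0 < g (x n) ω}.indicator (1 : Ω → ENNReal) ω)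
          Filter.atTop ∂μ := by
        refine lintegral_mono fun ω => ?_
        by_cases hω : 0 < g z ω
        · have hev : ∀ᶠ n in Filter.atTop, 0 < g (x n) ω :=
            (((hgc ω).tendsto z).comp hlim).eventually (lt_mem_nhds hω)
          rw [Set.indicator_of_mem (show ω ∈ {ω | 0 < g z ω} from hω)]
          refine Filter.le_liminf_of_le (by isBoundedDefault) ?_
          filter_upwards [hev] with n hn
          rw [Set.indicator_of_mem (show ω ∈ {ω | 0 < g (x n) ω} from hn)]
        · rw [Set.indicator_of_notMem (show ω ∉ {ω | 0 < g z ω} from hω)]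
          exact bot_le
    _ ≤ Filter.liminf (fun n => ∫⁻ ω, {ω | 0 < g (x n) ω}.indicator 1 ω ∂μ) Filter.atTop :=
        lintegral_liminf_le fun n => measurable_one.indicator (hm (x n))
    _ = Filter.liminf (fun n => μ {ω | 0 < g (x n) ω}) Filter.atTop := by
        simp_rw [lintegral_indicator_one (hm _)]
    _ ≤ a := Filter.liminf_le_of_le (by isBoundedDefault) fun b hb => by
        obtain ⟨n, hn⟩ := hb.exists
        exact hn.trans (hx n)

end Measurability

/-! ### Majority votes -/

/-- A majority of independent errors, each of probability `v ≤ 1 / 2`, has probability at most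
`v`. -/
theorem sum_majority_le {N : ℕ} (hN : 0 < N) {v : ℝ} (hv : 0 ≤ v) (hv' : v ≤ 1 / 2) :
    ∑ S : Finset (Fin N) with N < 2 * S.card, v ^ S.card * (1 - v) ^ (N - S.card) ≤ v := by
  set p : Finset (Fin N) → ℝ := fun S => v ^ S.card * (1 - v) ^ (N - S.card) with hp
  have hmean : ∑ S : Finset (Fin N), (S.card : ℝ) * p S = N * v := by
    have h1 := Finset.sum_powerset_apply_card
      (fun m => (m : ℝ) * (v ^ m * (1 - v) ^ (N - m))) (x := (Finset.univ : Finset (Fin N)))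
    have h2 := congrArg (Polynomial.eval v) (bernsteinPolynomial.sum_smul ℝ N)
    simp only [Polynomial.eval_finsetSum, bernsteinPolynomial,
      Polynomial.eval_mul, Polynomial.eval_pow, Polynomial.eval_sub, Polynomial.eval_one,
      Polynomial.eval_X, Polynomial.eval_natCast, nsmul_eq_mul] at h2
    rw [Finset.powerset_univ] at h1
    rw [h1, ← h2]
    simp only [Finset.card_univ, Fintype.card_fin, nsmul_eq_mul]
    exact Finset.sum_congr rfl fun m _ => by ring
  have hNpos : (0 : ℝ) < N := by exact_mod_cast hN
  -- The claim is `∑ w ≥ 0`, by the mean `N * v`. Pairing a majority `S` with its complement gives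
  -- `w S + w Sᶜ = (N - |S|) (p Sᶜ - p S)`, which is nonnegative because `v ≤ 1 - v`.
  set w : Finset (Fin N) → ℝ := fun S =>
    (S.card : ℝ) * p S - if N < 2 * S.card then N * p S else 0 with hw
  have hcompl : ∑ S, w Sᶜ = ∑ S, w S :=
    Fintype.sum_bijective compl (compl_involutive.bijective) _ _ fun _ => rfl
  have hp0 : ∀ S, 0 ≤ p S := fun S =>
    mul_nonneg (pow_nonneg hv _) (pow_nonneg (by linarith) _)
  have key : ∀ S : Finset (Fin N), N < 2 * S.card → 0 ≤ w S + w Sᶜ := by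
    intro S hS
    have hle : S.card ≤ N := by simpa using S.card_le_univ
    have hc : Sᶜ.card = N - S.card := by simp [Finset.card_compl]
    have hnot : ¬ N < 2 * (N - S.card) := by omega
    have hpp : p S ≤ p Sᶜ := by
      have e1 : N - (N - S.card) = (N - S.card) + (2 * S.card - N) := by omega
      have e2 : S.card = (N - S.card) + (2 * S.card - N) := by omega
      have e3 : p S = v ^ (N - S.card) * (1 - v) ^ (N - S.card) * v ^ (2 * S.card - N) := by
        simp only [hp]
        conv_lhs => rw [show v ^ S.card = v ^ (N - S.card) * v ^ (2 * S.card - N) by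
          rw [← pow_add, ← e2]]
        ring
      have e4 : p Sᶜ = v ^ (N - S.card) * (1 - v) ^ (N - S.card) * (1 - v) ^ (2 * S.card - N) := by
        simp only [hp, hc]
        rw [e1, pow_add]
        ring
      rw [e3, e4]
      exact mul_le_mul_of_nonneg_left (pow_le_pow_left₀ hv (by linarith) _)
        (mul_nonneg (pow_nonneg hv _) (pow_nonneg (by linarith) _))
    have hcast : ((N - S.card : ℕ) : ℝ) = N - S.card := by push_cast [hle]; ring
    have hle' : (S.card : ℝ) ≤ N := by exact_mod_cast hle
    simp only [hw, if_pos hS, if_neg hnot, hc, hcast]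
    nlinarith
  have key' : ∀ S, 0 ≤ w S + w Sᶜ := by
    intro S
    by_cases hS : N < 2 * S.card
    · exact key S hS
    by_cases hS' : N < 2 * Sᶜ.card
    · have := key Sᶜ hS'
      rw [compl_compl] at this
      linarith
    · simp only [hw, if_neg hS, if_neg hS', sub_zero]
      exact add_nonneg (mul_nonneg (Nat.cast_nonneg _) (hp0 _))
        (mul_nonneg (Nat.cast_nonneg _) (hp0 _))
  have htot : 0 ≤ ∑ S, w S := by
    have := Finset.sum_nonneg fun S (_ : S ∈ Finset.univ) => key' S
    rw [Finset.sum_add_distrib, hcompl] at this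
    linarith
  simp only [hw, Finset.sum_sub_distrib, hmean, ← Finset.sum_filter, ← Finset.mul_sum] at htot
  exact le_of_mul_le_mul_left (by linarith) hNpos

/-- The event that most of `N` independent draws fall into a set of probability at most `1 / 2` is
no more likely than a single draw doing so. -/
theorem measure_pi_majority_le {Ξ : Type*} [MeasurableSpace Ξ] (μ : Measure Ξ)
    [IsProbabilityMeasure μ] {N : ℕ} (hN : 0 < N) {B : Set Ξ} (hB : MeasurableSet B)
    (hB' : μ.real B ≤ 1 / 2) [DecidablePred (· ∈ B)] :
    (Measure.pi fun _ : Fin N => μ)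
      {ξ | N < 2 * (Finset.univ.filter fun i => ξ i ∈ B).card} ≤ ENNReal.ofReal (μ.real B) := by
  set v := μ.real B with hv
  have hv0 : 0 ≤ v := measureReal_nonneg
  have hμB : μ B = ENNReal.ofReal v := (ofReal_measureReal).symm
  have hμB' : μ Bᶜ = ENNReal.ofReal (1 - v) := by
    rw [← probReal_compl_eq_one_sub hB, ofReal_measureReal]
  set R : Finset (Fin N) → Set (Fin N → Ξ) := fun S =>
    Set.univ.pi fun i => if i ∈ S then B else Bᶜ with hR
  have hRS : ∀ S, (Measure.pi fun _ : Fin N => μ) (R S) =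
      ENNReal.ofReal (v ^ S.card * (1 - v) ^ (N - S.card)) := by
    intro S
    rw [hR, Measure.pi_pi]
    have : ∀ i, μ (if i ∈ S then B else Bᶜ) =
        if i ∈ S then ENNReal.ofReal v else ENNReal.ofReal (1 - v) := by
      intro i
      split_ifs
      · exact hμB
      · exact hμB'
    simp_rw [this]
    rw [Finset.prod_ite, Finset.prod_const, Finset.prod_const, ENNReal.ofReal_mul (pow_nonneg hv0 _),
      ENNReal.ofReal_pow hv0, ENNReal.ofReal_pow (by linarith)]
    congr 3
    · simp
    · rw [Finset.filter_not, Finset.card_sdiff_of_subset (Finset.filter_subset _ _)]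
      simp
  calc (Measure.pi fun _ : Fin N => μ) {ξ | N < 2 * (Finset.univ.filter fun i => ξ i ∈ B).card}
      ≤ (Measure.pi fun _ : Fin N => μ)
          (⋃ S ∈ Finset.univ.filter fun S : Finset (Fin N) => N < 2 * S.card, R S) := by
        refine measure_mono fun ξ hξ => ?_
        refine Set.mem_iUnion₂.2 ⟨Finset.univ.filter fun i => ξ i ∈ B,
          Finset.mem_filter.2 ⟨Finset.mem_univ _, hξ⟩, fun i _ => ?_⟩
        by_cases hi : ξ i ∈ B <;> simp [hi]
    _ ≤ ∑ S : Finset (Fin N) with N < 2 * S.card, (Measure.pi fun _ : Fin N => μ) (R S) :=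
        measure_biUnion_finset_le _ _
    _ = ENNReal.ofReal (∑ S : Finset (Fin N) with N < 2 * S.card,
          v ^ S.card * (1 - v) ^ (N - S.card)) := by
        rw [ENNReal.ofReal_sum_of_nonneg fun S _ =>
          mul_nonneg (pow_nonneg hv0 _) (pow_nonneg (by linarith) _)]
        exact Finset.sum_congr rfl fun S _ => hRS S
    _ ≤ ENNReal.ofReal v := ENNReal.ofReal_le_ofReal (sum_majority_le hN hv0 hB')

/-! ### Testing a subsample's solution on the remaining sample -/

/-- The points of `D` that satisfy the constraint `g · ξ ≤ 0` for each parameter of a family. -/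
def feasible {Ξ E ι : Type*} (g : E → Ξ → ℝ) (D : Set E) (ξ : ι → Ξ) : Set E :=
  {x | x ∈ D ∧ ∀ i, g x (ξ i) ≤ 0}

section Scenario

variable {Ξ E : Type*} [MeasurableSpace Ξ] [PseudoMetricSpace E] [SigmaCompactSpace E]
  {g : E → Ξ → ℝ} {D : Set E} {L : List (E → ℝ)}

theorem isRandomClosed_feasible {ι : Type*} [Finite ι] (hgc : ∀ ξ, Continuous fun x => g x ξ)
    (hgm : ∀ x, Measurable (g x)) (hD : IsClosed D) :
    IsRandomClosed fun ξ : ι → Ξ => feasible g D ξ :=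
  isRandomClosed_constraints (Ω := ι → Ξ) hD (fun i x ξ => g x (ξ i)) (fun i ξ => hgc (ξ i))
    fun i x => (hgm x).comp (measurable_pi_apply i)

/-- Pairs of samples such that the solution for the first one is violated with probability more
than `a`, but satisfies all constraints of the second one. -/
def deceived {ι κ : Type*} (μ : Measure Ξ) (g : E → Ξ → ℝ) (D : Set E) (L : List (E → ℝ))
    (a : ENNReal) : Set ((ι → Ξ) × (κ → Ξ)) :=
  {p | (lexArgmin L (feasible g D p.1) ∩ feasible g D p.2 ∩ {x | a < μ {ξ | 0 < g x ξ}}).Nonempty}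

theorem measurableSet_deceived {ι κ : Type*} [Finite ι] [Finite κ] (μ : Measure Ξ)
    (hgc : ∀ ξ, Continuous fun x => g x ξ) (hgm : ∀ x, Measurable (g x)) (hD : IsClosed D)
    (hL : ∀ f ∈ L, Continuous f) (a : ENNReal) :
    MeasurableSet (deceived (ι := ι) (κ := κ) μ g D L a) :=
  ((((isRandomClosed_feasible hgc hgm hD).comp measurable_fst).lexArgmin L hL).inter
    ((isRandomClosed_feasible hgc hgm hD).comp measurable_snd)).measurableSet_hit_isOpen
    (isOpen_lt_measure_pos μ g hgc hgm a)

/-- With the first sample fixed, `hsep` leaves at most one lexicographic minimizer. The second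
sample is independent of it, and each of its constraints is satisfied with probability at most `1 -
a`. -/
theorem measure_deceived_le {ι κ : Type*} [hι : Fintype ι] [hκ : Fintype κ] (μ : Measure Ξ)
    [IsProbabilityMeasure μ] (hgc : ∀ ξ, Continuous fun x => g x ξ) (hgm : ∀ x, Measurable (g x))
    (hD : IsClosed D) (hL : ∀ f ∈ L, Continuous f)
    (hsep : ∀ x y, (∀ f ∈ L, f x = f y) → x = y) (a : ENNReal) :
    ((Measure.pi fun _ : ι => μ).prod (Measure.pi fun _ : κ => μ)) (deceived μ g D L a) ≤
      (1 - a) ^ Fintype.card κ := by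
  rw [Measure.prod_apply (measurableSet_deceived μ hgc hgm hD hL a)]
  have hsec : ∀ ξ : ι → Ξ, (Measure.pi fun _ : κ => μ) (Prod.mk ξ ⁻¹' deceived μ g D L a) ≤
      (1 - a) ^ Fintype.card κ := by
    intro ξ
    rcases Set.eq_empty_or_nonempty
      (lexArgmin L (feasible g D ξ) ∩ {x | a < μ {ξ | 0 < g x ξ}}) with hemp | ⟨x, hx, hxa⟩
    · have : Prod.mk ξ ⁻¹' deceived (κ := κ) μ g D L a = ∅ := by
        refine Set.eq_empty_of_forall_notMem ?_
        rintro η ⟨y, ⟨hy, -⟩, hya⟩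
        exact Set.eq_empty_iff_forall_notMem.1 hemp y ⟨hy, hya⟩
      rw [this, measure_empty]
      exact bot_le
    · have hsub : Prod.mk ξ ⁻¹' deceived (κ := κ) μ g D L a ⊆
          Set.univ.pi fun _ => {ξ | 0 < g x ξ}ᶜ := by
        rintro η ⟨y, ⟨hy, hyη⟩, -⟩ i -
        obtain rfl : y = x := hsep y x fun f hf => eq_of_mem_lexArgmin L _ hy hx hf
        exact not_lt.2 (hyη.2 i)
      refine (measure_mono hsub).trans ?_
      rw [Measure.pi_pi, Finset.prod_const, Finset.card_univ,
        prob_compl_eq_one_sub (measurableSet_lt measurable_const (hgm x))]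
      exact pow_le_pow_left' (tsub_le_tsub_left (le_of_lt hxa) 1) _
  calc _ ≤ ∫⁻ _, (1 - a) ^ Fintype.card κ ∂(Measure.pi fun _ : ι => μ) := lintegral_mono hsec
    _ = _ := by simp

/-- Samples such that the solution for the subsample indexed by `J` is violated with probability
more than `a`, but satisfies all constraints of the sample. -/
def deceivedBy {N : ℕ} (μ : Measure Ξ) (g : E → Ξ → ℝ) (D : Set E) (L : List (E → ℝ))
    (a : ENNReal) (J : Finset (Fin N)) : Set (Fin N → Ξ) :=
  MeasurableEquiv.piEquivPiSubtypeProd (fun _ => Ξ) (· ∈ J) ⁻¹' deceived μ g D L a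

theorem measurableSet_deceivedBy {N : ℕ} (μ : Measure Ξ) (hgc : ∀ ξ, Continuous fun x => g x ξ)
    (hgm : ∀ x, Measurable (g x)) (hD : IsClosed D) (hL : ∀ f ∈ L, Continuous f) (a : ENNReal)
    (J : Finset (Fin N)) : MeasurableSet (deceivedBy μ g D L a J) :=
  (MeasurableEquiv.piEquivPiSubtypeProd (fun _ => Ξ) (· ∈ J)).measurable
    (measurableSet_deceived μ hgc hgm hD hL a)

theorem measure_deceivedBy_le {N : ℕ} (μ : Measure Ξ) [IsProbabilityMeasure μ]
    (hgc : ∀ ξ, Continuous fun x => g x ξ) (hgm : ∀ x, Measurable (g x)) (hD : IsClosed D)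
    (hL : ∀ f ∈ L, Continuous f) (hsep : ∀ x y, (∀ f ∈ L, f x = f y) → x = y) (a : ENNReal)
    (J : Finset (Fin N)) :
    (Measure.pi fun _ : Fin N => μ) (deceivedBy μ g D L a J) ≤ (1 - a) ^ (N - J.card) := by
  have hmp := measurePreserving_piEquivPiSubtypeProd (fun _ : Fin N => μ) (· ∈ J)
  rw [deceivedBy, hmp.measure_preimage
    (measurableSet_deceived μ hgc hgm hD hL a).nullMeasurableSet]
  refine (measure_deceived_le (hι := _) (hκ := _) μ hgc hgm hD hL hsep a).trans_eq ?_
  rw [Fintype.card_subtype_compl, Fintype.card_fin, Fintype.card_coe]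

end Scenario

/-! ### Averaging over subsamples -/

theorem choose_le_card_supersets {N z M : ℕ} (hzM : z ≤ M) (I : Finset (Fin N)) (hI : I.card = z) :
    (N - z).choose (M - z) ≤ ((Finset.powersetCard M Finset.univ).filter (I ⊆ ·)).card := by
  have hcard : (Finset.powersetCard (M - z) Iᶜ).card = (N - z).choose (M - z) := by
    rw [Finset.card_powersetCard, Finset.card_compl, Fintype.card_fin, hI]
  rw [← hcard]
  refine Finset.card_le_card_of_injOn (I ∪ ·) ?_ ?_
  · intro T hT
    obtain ⟨hT1, hT2⟩ := Finset.mem_powersetCard.1 (Finset.mem_coe.1 hT)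
    have hdis : Disjoint I T := (Finset.subset_compl_iff_disjoint_left.1 hT1)
    refine Finset.mem_coe.2 (Finset.mem_filter.2 ⟨Finset.mem_powersetCard.2
      ⟨Finset.subset_univ _, ?_⟩, Finset.subset_union_left⟩)
    rw [Finset.card_union_of_disjoint hdis]
    omega
  · intro T hT T' hT' h
    have hd : ∀ U ∈ Finset.powersetCard (M - z) Iᶜ, (I ∪ U) \ I = U := fun U hU =>
      Finset.union_sdiff_cancel_left
        (Finset.subset_compl_iff_disjoint_left.1 (Finset.mem_powersetCard.1 hU).1)
    rw [← hd T hT, ← hd T' hT']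
    exact congrArg (· \ I) h

/-- If each point of `B` has a set of `z` indices all of whose supersets of size `M` are indices of
events it belongs to, then `B` is small when those events are. -/
theorem choose_mul_measure_le {Ω : Type*} [MeasurableSpace Ω] (P : Measure Ω) {N z M : ℕ}
    (hzM : z ≤ M) (A : Finset (Fin N) → Set Ω) (hA : ∀ J, MeasurableSet (A J)) (c : ENNReal)
    (hc : ∀ J, J.card = M → P (A J) ≤ c) (B : Set Ω)
    (hB : ∀ ω ∈ B, ∃ I : Finset (Fin N), I.card = z ∧ ∀ J, I ⊆ J → ω ∈ A J) :
    ((N - z).choose (M - z) : ENNReal) * P B ≤ N.choose M * c := by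
  -- `F` counts the events that occur and is large on `B`, so Markov's inequality applies to a
  -- superlevel set of `F`. Measurability of `B` itself is not needed.
  set F : Ω → ENNReal := fun ω => ∑ J ∈ Finset.powersetCard M Finset.univ, (A J).indicator 1 ω
    with hF
  have hFm : Measurable F :=
    Finset.measurable_fun_sum _ fun J _ => measurable_one.indicator (hA J)
  have hsub : B ⊆ {ω | ((N - z).choose (M - z) : ENNReal) ≤ F ω} := by
    intro ω hω
    obtain ⟨I, hI, hIJ⟩ := hB ω hω
    calc ((N - z).choose (M - z) : ENNReal)
        ≤ (((Finset.powersetCard M Finset.univ).filter (I ⊆ ·)).card : ENNReal) := by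
          exact_mod_cast choose_le_card_supersets hzM I hI
      _ = ∑ J ∈ (Finset.powersetCard M Finset.univ).filter (I ⊆ ·), (A J).indicator 1 ω := by
          rw [Finset.card_eq_sum_ones, Nat.cast_sum]
          refine Finset.sum_congr rfl fun J hJ => ?_
          rw [Set.indicator_of_mem (hIJ J (Finset.mem_filter.1 hJ).2)]
          simp
      _ ≤ F ω := Finset.sum_le_sum_of_subset (Finset.filter_subset _ _)
  calc ((N - z).choose (M - z) : ENNReal) * P B
      ≤ ((N - z).choose (M - z) : ENNReal) * P {ω | ((N - z).choose (M - z) : ENNReal) ≤ F ω} := by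
        gcongr
    _ ≤ ∫⁻ ω, F ω ∂P := mul_meas_ge_le_lintegral hFm _
    _ = ∑ J ∈ Finset.powersetCard M Finset.univ, P (A J) := by
        rw [hF, lintegral_finsetSum _ fun J _ => measurable_one.indicator (hA J)]
        exact Finset.sum_congr rfl fun J _ => lintegral_indicator_one (hA J)
    _ ≤ ∑ J ∈ Finset.powersetCard M (Finset.univ : Finset (Fin N)), c :=
        Finset.sum_le_sum fun J hJ => hc J (Finset.mem_powersetCard.1 hJ).2
    _ = N.choose M * c := by simp

/-- Factor by factor, `N - j ≤ 2 * (M - j)` for `j < z`. The tightest case `j = z - 1` is exactly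
`h`. -/
theorem choose_le_two_pow_mul_choose {N M z : ℕ} (h : N + z ≤ 2 * M + 1) (hz : z ≤ M) :
    N.choose z ≤ 2 ^ z * M.choose z := by
  induction z with
  | zero => simp
  | succ z ih =>
    have ih := ih (by omega) (by omega)
    refine Nat.le_of_mul_le_mul_right (c := z + 1) ?_ (Nat.succ_pos z)
    rw [Nat.choose_succ_right_eq, mul_assoc, Nat.choose_succ_right_eq]
    calc N.choose z * (N - z) ≤ (2 ^ z * M.choose z) * (2 * (M - z)) :=
          Nat.mul_le_mul ih (by omega)
      _ = _ := by ring

theorem choose_le_two_pow_mul_choose_sub {N M z : ℕ} (h : N + z ≤ 2 * M + 1) (hz : z ≤ M) :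
    N.choose M ≤ 2 ^ z * (N - z).choose (M - z) := by
  refine Nat.le_of_mul_le_mul_right (c := M.choose z) ?_ (Nat.choose_pos hz)
  rw [Nat.choose_mul hz]
  calc N.choose z * (N - z).choose (M - z) ≤ (2 ^ z * M.choose z) * (N - z).choose (M - z) :=
        Nat.mul_le_mul_right _ (choose_le_two_pow_mul_choose h hz)
    _ = _ := by ring

/-! ### Mixed-integer programs with random constraints -/

theorem isClosed_mixedFeatures (d k : ℕ) : IsClosed (mixedFeatures d k) := by
  have : mixedFeatures d k =
      ⋂ (i : Fin d) (_ : k ≤ i.val), (fun x : Fin d → ℝ => x i) ⁻¹' Set.range ((↑) : ℤ → ℝ) := by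
    ext x
    simp [mixedFeatures, eq_comm]
  rw [this]
  exact isClosed_iInter fun i => isClosed_iInter fun _ =>
    Int.isClosedEmbedding_coe_real.isClosed_range.preimage (continuous_apply i)

/-- The solution of a mixed-integer convex program stays optimal when all but suitable
`2 ^ (d - k) * (k + 1) - 1` of its constraints are dropped. -/
theorem exists_support_constraints {d k N : ℕ} (hk : k ≤ d) {Ξ : Type*} {g : (Fin d → ℝ) → Ξ → ℝ}
    (hg : ∀ ξ, ConvexOn ℝ Set.univ fun x => g x ξ) {K : Set (Fin d → ℝ)} (hK : Convex ℝ K)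
    {L : List ((Fin d → ℝ) → ℝ)} (hL : ∀ f ∈ L, ConvexOn ℝ Set.univ f) (ξ : Fin N → Ξ)
    {x : Fin d → ℝ} (hx : x ∈ lexArgmin L (feasible g (K ∩ mixedFeatures d k) ξ)) :
    ∃ I : Finset (Fin N), I.card ≤ 2 ^ (d - k) * (k + 1) - 1 ∧
      ∀ y ∈ K ∩ mixedFeatures d k, (∀ i ∈ I, g y (ξ i) ≤ 0) → ¬ LexLt L y x := by
  obtain ⟨⟨⟨hxK, hxM⟩, hxg⟩, hmin⟩ := (mem_lexArgmin_iff L _ x).1 hx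
  -- The index `none` stands for improvement over `x`, which accounts for the `- 1` in the bound.
  -- Placing `K` inside every member keeps it from costing another one. Small subfamilies without
  -- `none` meet at `x`, the others by `hcon`, so Helly would give a feasible improvement.
  let C : Option (Fin N) → Set (Fin d → ℝ) := fun o =>
    o.elim (K ∩ {y | LexLt L y x}) fun i => K ∩ {y | g y (ξ i) ≤ 0}
  have hC : ∀ o, Convex ℝ (C o) := by
    rintro (_ | i)
    · exact hK.inter (convex_lexLt L hL x)
    · have := (hg (ξ i)).convex_le 0
      simp only [Set.mem_univ, true_and] at this
      exact hK.inter this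
  have hpos : 0 < 2 ^ (d - k) * (k + 1) := by positivity
  by_contra! hcon
  obtain ⟨y, hyM, hy⟩ := isHellyNumber_mixedFeatures hk (Option (Fin N)) Finset.univ C
    (fun o _ => hC o) (by
      intro I _ hIc
      by_cases hnone : none ∈ I
      · obtain ⟨y, ⟨hyK, hyM⟩, hyI, hyx⟩ := hcon I.eraseNone (by
          rw [Finset.card_eraseNone_of_mem hnone]
          omega)
        refine ⟨y, hyM, ?_⟩
        rintro (_ | i) hi
        · exact ⟨hyK, hyx⟩
        · exact ⟨hyK, hyI i (Finset.mem_eraseNone.2 hi)⟩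
      · refine ⟨x, hxM, ?_⟩
        rintro (_ | i) hi
        · exact absurd hi hnone
        · exact ⟨hxK, hxg i⟩)
  have hyn := hy none (Finset.mem_univ _)
  exact hmin y ⟨⟨hyn.1, hyM⟩, fun i => (hy (some i) (Finset.mem_univ _)).2⟩ hyn.2

/-- The solution of a mixed-integer convex program with randomly sampled constraints is unlikely to
have a large probability of violation. -/
theorem measure_lt_violation_le {d k N : ℕ} (hk : k ≤ d) {Ξ : Type*} [MeasurableSpace Ξ]
    (μ : Measure Ξ) [IsProbabilityMeasure μ] {g : (Fin d → ℝ) → Ξ → ℝ}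
    (hg : ∀ ξ, ConvexOn ℝ Set.univ fun x => g x ξ) (hgm : ∀ x, Measurable (g x))
    {K : Set (Fin d → ℝ)} (hK : Convex ℝ K) (hKc : IsClosed K)
    {L : List ((Fin d → ℝ) → ℝ)} (hL : ∀ f ∈ L, ConvexOn ℝ Set.univ f)
    (hsep : ∀ x y, (∀ f ∈ L, f x = f y) → x = y) (a : ENNReal) {z M : ℕ}
    (hz : z = 2 ^ (d - k) * (k + 1) - 1) (hzM : z ≤ M) (hMN : M ≤ N) (hNM : N + z ≤ 2 * M + 1) :
    (Measure.pi fun _ : Fin N => μ)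
      {ξ | ∃ x ∈ lexArgmin L (feasible g (K ∩ mixedFeatures d k) ξ), a < μ {ξ | 0 < g x ξ}} ≤
      2 ^ z * (1 - a) ^ (N - M) := by
  have hcont : ∀ f : (Fin d → ℝ) → ℝ, ConvexOn ℝ Set.univ f → Continuous f := fun f hf =>
    continuousOn_univ.1 (hf.continuousOn isOpen_univ)
  have hgc : ∀ ξ, Continuous fun x => g x ξ := fun ξ => hcont _ (hg ξ)
  have hLc : ∀ f ∈ L, Continuous f := fun f hf => hcont f (hL f hf)
  have hD : IsClosed (K ∩ mixedFeatures d k) := hKc.inter (isClosed_mixedFeatures d k)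
  have hmain := choose_mul_measure_le (Measure.pi fun _ : Fin N => μ) hzM
    (deceivedBy μ g (K ∩ mixedFeatures d k) L a)
    (measurableSet_deceivedBy μ hgc hgm hD hLc a) ((1 - a) ^ (N - M))
    (fun J hJ => hJ ▸ measure_deceivedBy_le μ hgc hgm hD hLc hsep a J)
    {ξ | ∃ x ∈ lexArgmin L (feasible g (K ∩ mixedFeatures d k) ξ), a < μ {ξ | 0 < g x ξ}} (by
      rintro ξ ⟨x, hx, hxa⟩
      obtain ⟨I₀, hI₀, hmin⟩ := exists_support_constraints hk hg hK hL ξ hx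
      -- Padding to exactly `z` indices makes the number of supersets of size `M` uniform in the
      -- sample.
      obtain ⟨I, hI₀I, hI⟩ := Finset.exists_superset_card_eq (hz ▸ hI₀) (by
        rw [Fintype.card_fin]; omega)
      refine ⟨I, hI, fun J hIJ => ⟨x, ⟨?_, ?_⟩, hxa⟩⟩
      · have hxf := lexArgmin_subset L _ hx
        refine (mem_lexArgmin_iff L _ x).2 ⟨⟨hxf.1, fun i => hxf.2 i⟩, fun y hy => ?_⟩
        exact hmin y hy.1 fun i hi => hy.2 ⟨i, hIJ (hI₀I hi)⟩
      · have hxf := lexArgmin_subset L _ hx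
        exact ⟨hxf.1, fun i => hxf.2 i⟩)
  have hc0 : ((N - z).choose (M - z) : ENNReal) ≠ 0 := by
    exact_mod_cast (Nat.choose_pos (by omega)).ne'
  refine (ENNReal.mul_le_mul_iff_right hc0 (ENNReal.natCast_ne_top _)).1 (hmain.trans ?_)
  have hch : (N.choose M : ENNReal) ≤ 2 ^ z * (N - z).choose (M - z) := by
    exact_mod_cast choose_le_two_pow_mul_choose_sub hNM hzM
  calc (N.choose M : ENNReal) * (1 - a) ^ (N - M)
      ≤ 2 ^ z * (N - z).choose (M - z) * (1 - a) ^ (N - M) := by gcongr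
    _ = _ := by ring

/-! ### From violation probability to robustness -/

theorem not_lexLt_ofFn_append {E : Type*} {q : ℕ} (φ : Fin q → E → ℝ) (L : List (E → ℝ)) {x y : E}
    (h : toLex (fun j => φ j x) < toLex (fun j => φ j y)) : ¬ LexLt (List.ofFn φ ++ L) y x := by
  obtain ⟨i, heq, hlt⟩ := h
  induction q with
  | zero => exact i.elim0
  | succ q ih =>
    rw [List.ofFn_succ, List.cons_append]
    rintro (h0 | ⟨h0, h1⟩)
    · rcases Fin.eq_zero_or_eq_succ i with rfl | ⟨j, rfl⟩
      · exact lt_asymm h0 hlt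
      · exact h0.ne' (heq 0 (Fin.succ_pos j))
    · rcases Fin.eq_zero_or_eq_succ i with rfl | ⟨j, rfl⟩
      · exact hlt.ne' h0
      · exact ih (fun l => φ l.succ) j (fun l hl => heq l.succ (Fin.succ_lt_succ_iff.2 hl)) hlt h1

theorem not_lexLt_self {E : Type*} (L : List (E → ℝ)) (x : E) : ¬ LexLt L x x := by
  induction L with
  | nil => exact id
  | cons f L ih => simp [LexLt, ih]

theorem IsSolution.mem_lexArgmin {d q : ℕ} {f : (Fin d → ℝ) → ℝ} {φ : Fin q → (Fin d → ℝ) → ℝ}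
    {A : Set (Fin d → ℝ)} {x : Fin d → ℝ} (h : IsSolution f φ A x) (L : List ((Fin d → ℝ) → ℝ)) :
    x ∈ lexArgmin (f :: (List.ofFn φ ++ L)) A := by
  obtain ⟨hxA, hmin, huniq⟩ := h
  refine (mem_lexArgmin_iff _ _ _).2 ⟨hxA, fun y hy hlt => ?_⟩
  by_cases hyx : y = x
  · subst hyx
    exact not_lexLt_self _ _ hlt
  · rcases hlt with hlt | ⟨heq, hlt⟩
    · exact absurd hlt (not_lt.2 (hmin y hy))
    · exact not_lexLt_ofFn_append φ L (huniq y hy hyx heq) hlt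

theorem ensemble_eq_one_iff {Ξ : Type*} {d N : ℕ} (hN : 0 < N) (t : (Fin d → ℝ) → Ξ → Fin 2)
    (x : Fin d → ℝ) (ξ : Fin N → Ξ) :
    ensemble t x ξ = 1 ↔ 2 * (Finset.univ.filter fun i => t x (ξ i) ≠ 1).card ≤ N := by
  have hval : ∀ i, ((t x (ξ i)).val : ℝ) = if t x (ξ i) = 1 then 1 else 0 := by
    intro i
    generalize t x (ξ i) = c
    fin_cases c <;> simp
  have hsplit := Finset.card_filter_add_card_filter_not (s := Finset.univ)
    fun i : Fin N => t x (ξ i) = 1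
  rw [Finset.card_univ, Fintype.card_fin] at hsplit
  have hN' : (0 : ℝ) < N := by exact_mod_cast hN
  have hsc : 1 / 2 ≤ score t x ξ ↔ N ≤ 2 * (Finset.univ.filter fun i => t x (ξ i) = 1).card := by
    rw [score]
    simp_rw [hval]
    rw [Finset.sum_boole, one_div_mul_eq_div, div_le_div_iff₀ two_pos hN', one_mul]
    constructor <;> intro h
    · have : (N : ℝ) ≤ ((2 * (Finset.univ.filter fun i => t x (ξ i) = 1).card : ℕ) : ℝ) := by
        push_cast; linarith
      exact_mod_cast this
    · have : (N : ℝ) ≤ ((2 * (Finset.univ.filter fun i => t x (ξ i) = 1).card : ℕ) : ℝ) := by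
        exact_mod_cast h
      push_cast at this
      linarith
  have hens : ensemble t x ξ = 1 ↔ 1 / 2 ≤ score t x ξ := by
    rw [ensemble]
    by_cases h : 1 / 2 ≤ score t x ξ
    · rw [if_pos h]
      exact iff_of_true rfl h
    · rw [if_neg h]
      exact iff_of_false zero_ne_one h
  rw [hens, hsc]
  simp only [ne_eq]
  omega

/-- A point that a single base learner rejects with probability at most `α ≤ 1 / 2` is robust. -/
theorem isRobust_of_measure_le {Ξ : Type*} [MeasurableSpace Ξ] (μ : Measure Ξ)
    [IsProbabilityMeasure μ] {N d : ℕ} (hN : 0 < N) (t : (Fin d → ℝ) → Ξ → Fin 2) {α : ℝ}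
    (hα : 0 < α) (hα' : α ≤ 1 / 2) (x : Fin d → ℝ) (hm : MeasurableSet {ξ | t x ξ ≠ 1})
    (h : μ {ξ | t x ξ ≠ 1} ≤ ENNReal.ofReal α) : IsRobust μ N t α x := by
  have hreal : μ.real {ξ | t x ξ ≠ 1} ≤ α := ENNReal.toReal_le_of_le_ofReal hα.le h
  have hmaj := measure_pi_majority_le μ hN hm (hreal.trans hα')
  have hcover : (Set.univ : Set (Fin N → Ξ)) ⊆ {ξ | ensemble t x ξ = 1} ∪
      {ξ | N < 2 * (Finset.univ.filter fun i => ξ i ∈ {ξ | t x ξ ≠ 1}).card} := by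
    intro ξ _
    by_cases hξ : ensemble t x ξ = 1
    · exact Or.inl hξ
    · right
      rw [ensemble_eq_one_iff hN, not_le] at hξ
      simpa using hξ
  rw [IsRobust, ENNReal.ofReal_sub _ hα.le, ENNReal.ofReal_one, tsub_le_iff_right]
  calc (1 : ENNReal) = ensembleLaw μ N Set.univ := by simp [ensembleLaw]
    _ ≤ _ := (measure_mono hcover).trans (measure_union_le _ _)
    _ ≤ _ := by
      gcongr
      exact hmaj.trans (ENNReal.ofReal_le_ofReal hreal)

/-- Uses `2 ≤ 1 / α` and `1 - α ≤ exp (-α)`. Since `m ≥ (N - z) / 2`, a term `α * z / 2` would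
suffice where the exponent has `α * z`. -/
theorem two_pow_mul_one_sub_pow_le_exp {α : ℝ} (hα : 0 < α) (hα' : α ≤ 1 / 2) {z m N : ℕ}
    (hm : N ≤ 2 * m + z) :
    2 ^ z * (1 - α) ^ m ≤ Real.exp (z * (Real.log (1 / α) + α) - α / 2 * N) := by
  have h1 : (2 : ℝ) ^ z ≤ Real.exp (z * Real.log (1 / α)) := by
    rw [Real.exp_nat_mul, Real.exp_log (by positivity)]
    refine pow_le_pow_left₀ (by norm_num) ?_ _
    rw [le_div_iff₀ hα]
    linarith
  have h2 : (1 - α) ^ m ≤ Real.exp (m * -α) := by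
    rw [Real.exp_nat_mul]
    exact pow_le_pow_left₀ (by linarith) (Real.one_sub_le_exp_neg α) _
  have hm' : (N : ℝ) ≤ 2 * m + z := by exact_mod_cast hm
  calc 2 ^ z * (1 - α) ^ m ≤ Real.exp (z * Real.log (1 / α)) * Real.exp (m * -α) :=
        mul_le_mul h1 h2 (pow_nonneg (by linarith) _) (Real.exp_nonneg _)
    _ = Real.exp (z * Real.log (1 / α) + m * -α) := (Real.exp_add _ _).symm
    _ ≤ _ := by
      refine Real.exp_le_exp.2 ?_
      have hz : (0 : ℝ) ≤ z := Nat.cast_nonneg z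
      nlinarith [mul_nonneg hα.le hz, mul_le_mul_of_nonneg_left hm' hα.le]

theorem proposition5 {Ξ : Type*} [MeasurableSpace Ξ] (μ : Measure Ξ) [IsProbabilityMeasure μ]
    (N d k : ℕ) (hk : k ≤ d)
    -- the base learner
    (t : (Fin d → ℝ) → Ξ → Fin 2) (ht : IsConvexLearner d k t)
    -- the admissible domain: the mixed feature vectors in a closed convex set
    (K : Set (Fin d → ℝ)) (hK : Convex ℝ K) (hKc : IsClosed K)
    -- the distance function and the new observation
    (f : (Fin d → ℝ) → (Fin d → ℝ) → ℝ) (hf : ∀ u, ConvexOn ℝ Set.univ (fun x => f x u))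
    (xnew : Fin d → ℝ)
    -- the tie-breaking functions
    (q : ℕ) (φ : Fin q → (Fin d → ℝ) → ℝ) (hφ : ∀ j, ConvexOn ℝ Set.univ (φ j))
    (α : ℝ) (hα : 0 < α) (hα' : α ≤ 1 / 2) :
    ensembleLaw μ N
        {ξ₀ | ∀ x, IsSolution (fun y => f y xnew) φ
            (convexApproxFeasible t (K ∩ mixedFeatures d k) ξ₀) x →
          IsRobustCounterfactual μ t (K ∩ mixedFeatures d k) α ξ₀ x}ᶜ
      ≤ ENNReal.ofReal (Real.exp
          (((2 : ℝ) ^ (d - k) * ((k : ℝ) + 1) - 1) * (Real.log (1 / α) + α) - α / 2 * N)) := by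
  have hpos : 0 < 2 ^ (d - k) * (k + 1) := by positivity
  obtain ⟨z, hz⟩ : ∃ z, z = 2 ^ (d - k) * (k + 1) - 1 := ⟨_, rfl⟩
  have hzr : (2 : ℝ) ^ (d - k) * ((k : ℝ) + 1) - 1 = z := by
    rw [hz, Nat.cast_sub hpos]
    push_cast
    ring
  rw [hzr]
  -- Here the bound is at least 1. The empty ensemble must be set aside because its score is `0`, so
  -- it never predicts the target class.
  by_cases hN : N = 0 ∨ N < z
  · refine (show (Measure.pi fun _ : Fin N => μ) _ ≤ 1 from prob_le_one).trans ?_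
    rw [← ENNReal.ofReal_one]
    refine ENNReal.ofReal_le_ofReal ?_
    have := two_pow_mul_one_sub_pow_le_exp hα hα' (z := z) (m := 0) (N := N) (by omega)
    exact (one_le_pow₀ (by norm_num : (1 : ℝ) ≤ 2)).trans (by simpa using this)
  obtain ⟨hN0, hzN⟩ : 0 < N ∧ z ≤ N := by omega
  obtain ⟨g, hg, hgm, hgt⟩ := ht
  -- Appending the coordinates makes lexicographic minimizers unique for every subsample, even one
  -- where `φ` leaves ties. A solution for the full sample is unaffected.
  set L : List ((Fin d → ℝ) → ℝ) :=
    (fun y => f y xnew) :: (List.ofFn φ ++ List.ofFn fun (i : Fin d) x => x i) with hLdef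
  have hL : ∀ h ∈ L, ConvexOn ℝ Set.univ h := by
    intro h hh
    simp only [hLdef, List.mem_cons, List.mem_append, List.mem_ofFn'] at hh
    rcases hh with rfl | ⟨j, rfl⟩ | ⟨i, rfl⟩
    · exact hf xnew
    · exact hφ j
    · exact (LinearMap.proj (R := ℝ) (φ := fun _ : Fin d => ℝ) i).convexOn convex_univ
  have hsep : ∀ x y, (∀ h ∈ L, h x = h y) → x = y := by
    intro x y hxy
    funext i
    exact hxy (fun x => x i) (by simp [hLdef, List.mem_ofFn'])
  have hfeas : ∀ ξ₀ : Fin N → Ξ, convexApproxFeasible t (K ∩ mixedFeatures d k) ξ₀ =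
      feasible g (K ∩ mixedFeatures d k) ξ₀ := by
    intro ξ₀
    ext x
    exact and_congr_right fun hx => forall_congr' fun i => hgt x hx.2 (ξ₀ i)
  -- Rounding `(N + z) / 2` down gives both `N + z ≤ 2 * M + 1`, for the binomial ratio, and `2 * M
  -- ≤ N + z`, for the exponent.
  refine (measure_mono ?_).trans ((measure_lt_violation_le hk μ hg hgm hK hKc hL hsep
    (ENNReal.ofReal α) hz (M := (N + z) / 2) (by omega) (by omega) (by omega)).trans ?_)
  · intro ξ₀ hξ₀
    simp only [Set.mem_compl_iff, Set.mem_ofPred_eq, not_forall] at hξ₀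
    obtain ⟨x, hsol, hnot⟩ := hξ₀
    have hxA := hsol.1
    rw [hfeas] at hsol
    refine ⟨x, hsol.mem_lexArgmin _, ?_⟩
    by_contra! hle
    have hset : {ξ | t x ξ ≠ 1} = {ξ | 0 < g x ξ} := by
      ext ξ
      simp [hgt x hxA.1.2 ξ]
    refine hnot ⟨hxA.1, ?_, isRobust_of_measure_le μ hN0 t hα hα' x ?_ ?_⟩
    · rw [ensemble_eq_one_iff hN0]
      simp [hxA.2]
    · rw [hset]
      exact measurableSet_lt measurable_const (hgm x)
    · rwa [hset]
  · rw [← ENNReal.ofReal_one, ← ENNReal.ofReal_sub _ hα.le,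
      ← ENNReal.ofReal_pow (by linarith), ← ENNReal.ofReal_ofNat 2, ← ENNReal.ofReal_pow (by norm_num),
      ← ENNReal.ofReal_mul (by positivity)]
    exact ENNReal.ofReal_le_ofReal (two_pow_mul_one_sub_pow_le_exp hα hα' (by omega))
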